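/- Let $n\ge 1$ and let $D_{4n}=\langle a,b\mid a^{2n}=b^2=e,\ aba=b\rangle$ be the dihedral group of order $4n$. Write $R=\mathbb Z[D_{4n}]$ and $\Sigma=\sum_{i=0}^{2n-1}a^i$. Consider the exact sequence of right $R$-modules $$0\to J\hookrightarrow R^3\xrightarrow{\ \partial_2\ }R^2\xrightarrow{\ \partial_1\ }R\xrightarrow{\ \varepsilon\ }\mathbb Z\to 0 ,$$ where $\varepsilon$ is the augmentation, $J=\ker\partial_2$, and $\partial_1,\partial_2$ are left multiplication of column vectors by $$\partial_1=\begin{pmatrix}a-1&b-1\end{pmatrix},\qquad \partial_2=\begin{pmatrix}\Sigma&0&1+ba\\0&1+b&a-1\end{pmatrix}.$$ Every $R$-endomorphism $\alpha$ of $J$ is the restriction of a chain map of $R^3\to R^2\to R$ to itself; such a chain map induces multiplication by an integer $k$ on $\operatorname{coker}\partial_1=\mathbb Z$, and the class of $k$ in $\mathbb Z/4n$ depends only on $\alpha$. The Swan map $\operatorname{Aut}_R(J)\to(\mathbb Z/4n)^*$ is the homomorphism sending $\alpha$ to this class. Suppose that $3$ is a unit modulo $4n$. Then $3$ lies in the image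 of the Swan map $\operatorname{Aut}_R(J)\to(\mathbb Z/4n)^*$. More precisely, left multiplication by the matrices $$\alpha_0=1+a+b,\qquad \alpha_1=\begin{pmatrix}1+a-ba&b-1\\0&1\end{pmatrix},\qquad \alpha_2=\begin{pmatrix}1+a-ba&0&0\\0&1&0\\0&0&1\end{pmatrix}$$ on $R$, $R^2$, $R^3$ respectively is a chain map of $R^3\to R^2\to R$ to itself which induces multiplication by $3$ on $\mathbb Z$, and its restriction $\theta\colon J\to J$ is an $R$-automorphism that has determinant $-1$ as a $\mathbb Z$-linear map and is sent to $3$ by the Swan map. -/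

import Mathlib

open MulOpposite

universe u v

/-- The ring whose (left) modules are the right modules over the integral group ring `ℤ[G]`. -/
abbrev RightZG (G : Type u) [Group G] : Type u := (MonoidAlgebra ℤ G)ᵐᵒᵖ

/-- The element of `RightZG G` that acts as right multiplication by the group element `g`. -/
noncomputable def actBy {G : Type u} [Group G] (g : G) : RightZG G := op (MonoidAlgebra.of ℤ G g)

/-- An algebraic `2`-complex over `G`: finitely generated free right `ℤ[G]`-modules
`F₂ → F₁ → F₀`, exact at `F₁`, together with an identification (given by `ε`) of the cokernel
of `d₁` with `ℤ` carrying the trivial `G`-action. -/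
structure AlgebraicTwoComplex (G : Type u) [Group G] where
  F₀ : Type v
  F₁ : Type v
  F₂ : Type v
  [grp₀ : AddCommGroup F₀]
  [grp₁ : AddCommGroup F₁]
  [grp₂ : AddCommGroup F₂]
  [mod₀ : Module (RightZG G) F₀]
  [mod₁ : Module (RightZG G) F₁]
  [mod₂ : Module (RightZG G) F₂]
  [free₀ : Module.Free (RightZG G) F₀]
  [free₁ : Module.Free (RightZG G) F₁]
  [free₂ : Module.Free (RightZG G) F₂]
  [fin₀ : Module.Finite (RightZG G) F₀]
  [fin₁ : Module.Finite (RightZG G) F₁]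
  [fin₂ : Module.Finite (RightZG G) F₂]
  d₂ : F₂ →ₗ[RightZG G] F₁
  d₁ : F₁ →ₗ[RightZG G] F₀
  ε : F₀ →ₗ[ℤ] ℤ
  ε_act : ∀ (g : G) (x : F₀), ε (actBy g • x) = ε x
  ε_surjective : Function.Surjective ε
  exact₁ : ∀ y : F₁, d₁ y = 0 ↔ ∃ z : F₂, d₂ z = y
  exact₀ : ∀ x : F₀, ε x = 0 ↔ ∃ y : F₁, d₁ y = x

attribute [instance] AlgebraicTwoComplex.grp₀ AlgebraicTwoComplex.grp₁ AlgebraicTwoComplex.grp₂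
  AlgebraicTwoComplex.mod₀ AlgebraicTwoComplex.mod₁ AlgebraicTwoComplex.mod₂
  AlgebraicTwoComplex.free₀ AlgebraicTwoComplex.free₁ AlgebraicTwoComplex.free₂
  AlgebraicTwoComplex.fin₀ AlgebraicTwoComplex.fin₁ AlgebraicTwoComplex.fin₂

/-- Algebraic `π₂`: the kernel of `d₂`. -/
noncomputable abbrev AlgebraicTwoComplex.J {G : Type u} [Group G] (C : AlgebraicTwoComplex.{u, v} G) :
    Submodule (RightZG G) C.F₂ := LinearMap.ker C.d₂

/-- Chain maps between algebraic `2`-complexes. -/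
structure TwoChainMap {G : Type u} [Group G] (C C' : AlgebraicTwoComplex.{u, v} G) where
  f₂ : C.F₂ →ₗ[RightZG G] C'.F₂
  f₁ : C.F₁ →ₗ[RightZG G] C'.F₁
  f₀ : C.F₀ →ₗ[RightZG G] C'.F₀
  comm₂ : ∀ z, C'.d₂ (f₂ z) = f₁ (C.d₂ z)
  comm₁ : ∀ y, C'.d₁ (f₁ y) = f₀ (C.d₁ y)

/-- The chain map restricts to `α` on algebraic `π₂`. -/
def TwoChainMap.Induces {G : Type u} [Group G] {C C' : AlgebraicTwoComplex.{u, v} G}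
    (f : TwoChainMap C C') (α : C.J →ₗ[RightZG G] C'.J) : Prop :=
  ∀ x : C.J, f.f₂ (x : C.F₂) = (α x : C'.F₂)

/-- The chain map induces multiplication by `k` on the cokernels `ℤ`. -/
def TwoChainMap.InducesMul {G : Type u} [Group G] {C C' : AlgebraicTwoComplex.{u, v} G}
    (f : TwoChainMap C C') (k : ℤ) : Prop :=
  ∀ x : C.F₀, C'.ε (f.f₀ x) = k * C.ε x

section WellDefined

variable {G : Type u} [Group G]

theorem actBy_mul (g h : G) : actBy (g * h) = actBy h * actBy g := by
  rw [actBy, map_mul, op_mul]; rfl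

/-- An additive map commuting with the group action is linear over the group ring. -/
noncomputable def linOfEquivariant {B F : Type*} [AddCommGroup B] [AddCommGroup F]
    [Module (RightZG G) B] [Module (RightZG G) F] (Φ : B →+ F)
    (h : ∀ (g : G) (b : B), Φ (actBy g • b) = actBy g • Φ b) : B →ₗ[RightZG G] F where
  toFun := Φ
  map_add' := Φ.map_add
  map_smul' := by
    intro r b
    obtain ⟨r, rfl⟩ := op_surjective r
    simp only [RingHom.id_apply]
    induction r using MonoidAlgebra.induction_on with
    | of m => exact h m b
    | add x y hx hy => simp only [op_add, add_smul, map_add, hx, hy]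
    | smul k x hx =>
      have : op (k • x) = k • op x := rfl
      rw [this, smul_assoc, smul_assoc, map_zsmul, hx]

theorem intFree (F : Type v) [AddCommGroup F] [Module (RightZG G) F]
    [Module.Free (RightZG G) F] : Module.Free ℤ F :=
  Module.Free.trans (S := RightZG G)

theorem intFinite [Finite G] (F : Type v) [AddCommGroup F] [Module (RightZG G) F]
    [Module.Finite (RightZG G) F] : Module.Finite ℤ F := by
  have : Module.Finite ℤ (MonoidAlgebra ℤ G) := inferInstance
  have : Module.Finite ℤ (RightZG G) := Module.Finite.equiv (opLinearEquiv ℤ)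
  exact Module.Finite.trans (RightZG G) F

theorem exists_trace_one_ring [Fintype G] : ∃ p : RightZG G →+ RightZG G,
    ∀ x, ∑ g : G, actBy g * p (actBy g⁻¹ * x) = x := by
  classical
  refine ⟨AddMonoidHom.mk' (fun x => op (MonoidAlgebra.single 1 (x.unop.coeff 1))) ?_, ?_⟩
  · intro a b
    simp [← op_add]
  · intro x
    apply unop_injective
    obtain ⟨x, rfl⟩ := op_surjective x
    simp only [actBy, AddMonoidHom.mk'_apply, unop_mul, unop_op, Finset.unop_sum]
    ext h
    simp [MonoidAlgebra.coeff_sum]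

theorem exists_trace_one [Fintype G] (F : Type v) [AddCommGroup F] [Module (RightZG G) F]
    [Module.Free (RightZG G) F] : ∃ p : F →+ F,
    ∀ x, ∑ g : G, actBy g • p (actBy g⁻¹ • x) = x := by
  obtain ⟨p, hp⟩ := exists_trace_one_ring (G := G)
  let b := Module.Free.chooseBasis (RightZG G) F
  let q : F →+ F := (b.repr.symm.toLinearMap.toAddMonoidHom).comp
    ((Finsupp.mapRange.addMonoidHom p).comp b.repr.toLinearMap.toAddMonoidHom)
  refine ⟨q, fun x => ?_⟩
  apply b.repr.injective
  ext i
  rw [map_sum, Finsupp.finsetSum_apply]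
  rw [← hp (b.repr x i)]
  refine Finset.sum_congr rfl fun g _ => ?_
  simp [q]

/-- A map from `A = ker e ⊆ B` to a free module extends to `B` if `e` has values in a lattice. -/
theorem exists_extension [Fintype G] {B F E : Type v} [AddCommGroup B] [AddCommGroup F]
    [AddCommGroup E] [Module (RightZG G) B] [Module (RightZG G) F] [Module.Free (RightZG G) F]
    [Module.Free ℤ E] [Module.Finite ℤ E] (A : Submodule (RightZG G) B) (e : B →+ E)
    (he : ∀ x, x ∈ A ↔ e x = 0) (φ : A →ₗ[RightZG G] F) :
    ∃ Φ : B →ₗ[RightZG G] F, ∀ a : A, Φ a = φ a := by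
  obtain ⟨p, hp⟩ := exists_trace_one (G := G) F
  let e' := e.toIntLinearMap
  have hfree : Module.Free ℤ (LinearMap.range e') :=
    Module.Free.of_basis (Submodule.basisOfPid (Module.Free.chooseBasis ℤ E) _).2
  obtain ⟨s, hs⟩ := LinearMap.exists_rightInverse_of_surjective e'.rangeRestrict
    (LinearMap.range_eq_top.2 e'.surjective_rangeRestrict)
  have hs' : ∀ y, e (s y) = y := fun y => by
    have := LinearMap.congr_fun hs y
    exact congrArg Subtype.val this
  let ρ : B →+ A := AddMonoidHom.mk' (fun b => ⟨b - s (e'.rangeRestrict b), by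
      rw [he, map_sub, hs']; exact sub_self (e b)⟩) (by
    intro a b; ext; simp; abel)
  have hρ : ∀ a : A, ρ a = a := by
    intro a
    have h0 : e'.rangeRestrict (a : B) = 0 := by
      exact Subtype.ext ((he a).1 a.2)
    ext
    simp [ρ, h0]
  let Φ : B →+ F := AddMonoidHom.mk'
    (fun b => ∑ g : G, actBy g • p (φ (ρ (actBy g⁻¹ • b)))) (by
      intro a b
      simp only [smul_add, map_add, Finset.sum_add_distrib])
  refine ⟨linOfEquivariant Φ ?_, ?_⟩
  · intro h b
    change ∑ g : G, actBy g • p (φ (ρ (actBy g⁻¹ • actBy h • b)))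
      = actBy h • ∑ g : G, actBy g • p (φ (ρ (actBy g⁻¹ • b)))
    rw [Finset.smul_sum]
    refine (Fintype.sum_equiv (Equiv.mulRight h) _ _ fun g => ?_).symm
    simp only [Equiv.coe_mulRight, smul_smul, ← actBy_mul]
    simp
  · intro a
    change ∑ g : G, actBy g • p (φ (ρ (actBy g⁻¹ • (a : B)))) = φ a
    rw [← hp (φ a)]
    refine Finset.sum_congr rfl fun g _ => ?_
    rw [← Submodule.coe_smul, hρ, map_smul]

/-- For `B → C → E` exact at `C` with `E` a lattice, a map from `B` to a free module that
vanishes on the kernel of `B → C` factors through `C`. -/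
theorem exists_factor [Fintype G] {B C F E : Type v} [AddCommGroup B] [AddCommGroup C]
    [AddCommGroup F] [AddCommGroup E] [Module (RightZG G) B] [Module (RightZG G) C]
    [Module (RightZG G) F] [Module.Free (RightZG G) F]
    [Module.Free ℤ E] [Module.Finite ℤ E] (d : B →ₗ[RightZG G] C) (e : C →+ E)
    (he : ∀ x, e x = 0 ↔ ∃ y, d y = x) (g : B →ₗ[RightZG G] F)
    (hg : ∀ x, d x = 0 → g x = 0) :
    ∃ H : C →ₗ[RightZG G] F, ∀ x, g x = H (d x) := by
  have hle : LinearMap.ker d ≤ LinearMap.ker g := fun x hx => hg x hx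
  obtain ⟨H, hH⟩ := exists_extension (LinearMap.range d) e
    (fun x => by rw [he]; exact LinearMap.mem_range)
    ((Submodule.liftQ _ g hle) ∘ₗ d.quotKerEquivRange.symm.toLinearMap)
  refine ⟨H, fun x => ?_⟩
  have := hH ⟨d x, x, rfl⟩
  rw [this]
  have h2 : d.quotKerEquivRange.symm ⟨d x, x, rfl⟩ = Submodule.Quotient.mk x := by
    rw [LinearEquiv.symm_apply_eq]; ext; simp
  simp [h2]

end WellDefined

namespace AlgebraicTwoComplex

variable {G : Type u} [Group G] (C : AlgebraicTwoComplex.{u, v} G)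

theorem d₁_d₂ (z : C.F₂) : C.d₁ (C.d₂ z) = 0 := (C.exact₁ _).2 ⟨z, rfl⟩

theorem ε_d₁ (y : C.F₁) : C.ε (C.d₁ y) = 0 := (C.exact₀ _).2 ⟨y, rfl⟩

/-- Every endomorphism of algebraic `π₂` extends to a chain map, which induces multiplication by
some integer on `ℤ`. -/
theorem exists_chainMap [Finite G] (α : C.J →ₗ[RightZG G] C.J) :
    ∃ (k : ℤ) (f : TwoChainMap C C), f.Induces α ∧ f.InducesMul k := by
  have := Fintype.ofFinite G
  have := intFree (G := G) C.F₁
  have := intFinite (G := G) C.F₁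
  have := intFree (G := G) C.F₀
  have := intFinite (G := G) C.F₀
  obtain ⟨f₂, h₂⟩ := exists_extension C.J C.d₂.toAddMonoidHom (fun x => Iff.rfl)
    (C.J.subtype ∘ₗ α)
  obtain ⟨f₁, h₁⟩ := exists_factor C.d₂ C.d₁.toAddMonoidHom C.exact₁ (C.d₂ ∘ₗ f₂) (by
    intro x hx
    have := h₂ ⟨x, hx⟩
    simp only at this
    rw [LinearMap.comp_apply, this]
    exact (α ⟨x, hx⟩).2)
  obtain ⟨f₀, h₀⟩ := exists_factor C.d₁ (E := ULift.{v} ℤ)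
    ((AddEquiv.ulift.symm : ℤ ≃+ ULift.{v} ℤ).toAddMonoidHom.comp C.ε.toAddMonoidHom)
    (fun x => by
      rw [← C.exact₀]
      constructor
      · intro h
        exact congrArg ULift.down h
      · intro h
        exact congrArg ULift.up h) (C.d₁ ∘ₗ f₁) (by
    intro y hy
    obtain ⟨z, rfl⟩ := (C.exact₁ y).1 hy
    rw [LinearMap.comp_apply, ← h₁, LinearMap.comp_apply, C.d₁_d₂])
  obtain ⟨x₀, hx₀⟩ := C.ε_surjective 1
  refine ⟨C.ε (f₀ x₀), ⟨f₂, f₁, f₀, h₁, h₀⟩, h₂, fun x => ?_⟩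
  have hx : C.ε (x - C.ε x • x₀) = 0 := by simp [hx₀]
  obtain ⟨y, hy⟩ := (C.exact₀ _).1 hx
  have : C.ε (f₀ (x - C.ε x • x₀)) = 0 := by
    rw [← hy, ← h₀, LinearMap.comp_apply, C.ε_d₁]
  rw [map_sub, map_zsmul, map_sub, map_zsmul, smul_eq_mul, sub_eq_zero] at this
  rw [this, mul_comm]

/-- The integer induced on `ℤ` is determined modulo `|G|` by the map induced on `π₂`. -/
theorem chainMap_unique [Finite G] (α : C.J →ₗ[RightZG G] C.J) {k k' : ℤ}
    {f f' : TwoChainMap C C} (hf : f.Induces α) (hk : f.InducesMul k)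
    (hf' : f'.Induces α) (hk' : f'.InducesMul k') : (Nat.card G : ℤ) ∣ k - k' := by
  have := Fintype.ofFinite G
  have := intFree (G := G) C.F₁
  have := intFinite (G := G) C.F₁
  have := intFree (G := G) C.F₀
  have := intFinite (G := G) C.F₀
  obtain ⟨H₁, hH₁⟩ := exists_factor C.d₂ C.d₁.toAddMonoidHom C.exact₁ (f.f₂ - f'.f₂) (by
    intro x hx
    have h1 := hf ⟨x, hx⟩
    have h2 := hf' ⟨x, hx⟩
    simp only at h1 h2
    rw [LinearMap.sub_apply, h1, h2, sub_self])
  obtain ⟨H₀, hH₀⟩ := exists_factor C.d₁ (E := ULift.{v} ℤ)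
    ((AddEquiv.ulift.symm : ℤ ≃+ ULift.{v} ℤ).toAddMonoidHom.comp C.ε.toAddMonoidHom)
    (fun x => by
      rw [← C.exact₀]
      constructor
      · intro h
        exact congrArg ULift.down h
      · intro h
        exact congrArg ULift.up h) (f.f₁ - f'.f₁ - C.d₂ ∘ₗ H₁) (by
    intro y hy
    obtain ⟨z, rfl⟩ := (C.exact₁ y).1 hy
    simp only [LinearMap.sub_apply, LinearMap.comp_apply, ← hH₁, map_sub, f.comm₂, f'.comm₂,
      sub_self])
  obtain ⟨x₀, hx₀⟩ := C.ε_surjective 1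
  let D : C.F₀ →ₗ[RightZG G] C.F₀ := f.f₀ - f'.f₀ - C.d₁ ∘ₗ H₀
  have hD : ∀ x, C.ε x = 0 → D x = 0 := by
    intro x hx
    obtain ⟨y, rfl⟩ := (C.exact₀ x).1 hx
    simp only [D, LinearMap.sub_apply, LinearMap.comp_apply, ← hH₀, map_sub, f.comm₁, f'.comm₁,
      C.d₁_d₂, sub_zero, sub_self]
  have hinv : ∀ g : G, actBy g • D x₀ = D x₀ := by
    intro g
    rw [← sub_eq_zero, ← map_smul, ← map_sub]
    apply hD
    rw [map_sub, C.ε_act, sub_self]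
  have hε : C.ε (D x₀) = k - k' := by
    simp only [D, LinearMap.sub_apply, LinearMap.comp_apply, map_sub, C.ε_d₁, hk x₀, hk' x₀, hx₀]
    ring
  obtain ⟨p, hp⟩ := exists_trace_one (G := G) C.F₀
  have := congrArg C.ε (hp (D x₀))
  simp only [hinv, map_sum, C.ε_act, hε, Finset.sum_const, Finset.card_univ] at this
  rw [Nat.card_eq_fintype_card, ← this]
  exact ⟨C.ε (p (D x₀)), by simp⟩

/-- The `k`-invariant, an element of `ℤ/N` with `N = |G|`: the class of any integer `k` such that
some chain map restricts to `α` on `π₂` and induces multiplication by `k` on `ℤ`. -/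
noncomputable def kInvariant [Finite G] (N : ℕ) (_hN : Nat.card G = N)
    (α : C.J →ₗ[RightZG G] C.J) : ZMod N :=
  ((C.exists_chainMap α).choose : ℤ)

/-- The `k`-invariant may be computed from any chain map. -/
theorem kInvariant_eq [Finite G] (N : ℕ) (hN : Nat.card G = N)
    (α : C.J →ₗ[RightZG G] C.J) (f : TwoChainMap C C) (k : ℤ) (hf : f.Induces α)
    (hk : f.InducesMul k) : C.kInvariant N hN α = (k : ZMod N) := by
  obtain ⟨f', hf', hk'⟩ := (C.exists_chainMap α).choose_spec
  have := C.chainMap_unique α hf hk hf' hk'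
  rw [hN] at this
  exact (ZMod.intCast_eq_intCast_iff_dvd_sub _ _ _).2 this

/-- The `k`-invariant as a multiplicative map on the endomorphisms of `π₂`. -/
noncomputable def kappa [Finite G] (N : ℕ) (hN : Nat.card G = N) :
    Module.End (RightZG G) C.J →* ZMod N where
  toFun := C.kInvariant N hN
  map_one' := by
    rw [C.kInvariant_eq N hN 1 ⟨LinearMap.id, LinearMap.id, LinearMap.id, fun _ => rfl,
      fun _ => rfl⟩ 1 (fun _ => rfl) (fun x => by simp)]
    simp
  map_mul' := by
    intro α β
    obtain ⟨k, f, hf, hk⟩ := C.exists_chainMap α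
    obtain ⟨l, g, hg, hl⟩ := C.exists_chainMap β
    rw [C.kInvariant_eq N hN α f k hf hk, C.kInvariant_eq N hN β g l hg hl,
      C.kInvariant_eq N hN (α * β) ⟨f.f₂ ∘ₗ g.f₂, f.f₁ ∘ₗ g.f₁, f.f₀ ∘ₗ g.f₀,
        fun z => by simp [f.comm₂, g.comm₂], fun z => by simp [f.comm₁, g.comm₁]⟩ (k * l)
        (fun x => by
          simp only [LinearMap.comp_apply, Module.End.mul_apply]
          rw [hg x, hf (β x)])
        (fun x => by
          simp only [LinearMap.comp_apply]
          rw [hk, hl, mul_assoc])]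
    push_cast
    rfl

/-- The Swan map `Aut(J) → (ℤ/N)ˣ`, `N = |G|`, sending an automorphism to its `k`-invariant. -/
noncomputable def swanMap [Finite G] (N : ℕ) (hN : Nat.card G = N) :
    (C.J ≃ₗ[RightZG G] C.J) →* (ZMod N)ˣ :=
  (Units.map (C.kappa N hN)).comp
    (LinearMap.GeneralLinearGroup.generalLinearEquiv (RightZG G) C.J).symm.toMonoidHom

theorem coe_swanMap [Finite G] (N : ℕ) (hN : Nat.card G = N) (θ : C.J ≃ₗ[RightZG G] C.J) :
    (C.swanMap N hN θ : ZMod N) = C.kInvariant N hN θ.toLinearMap := rfl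

end AlgebraicTwoComplex

/-- Left multiplication of column vectors by a matrix over the group ring; it commutes with the
right action of the group ring. -/
noncomputable def matMap {G : Type u} [Group G] {k l : ℕ}
    (M : Matrix (Fin k) (Fin l) (MonoidAlgebra ℤ G)) :
    (Fin l → MonoidAlgebra ℤ G) →ₗ[RightZG G] (Fin k → MonoidAlgebra ℤ G) where
  toFun v := M.mulVec v
  map_add' v w := M.mulVec_add v w
  map_smul' r v := M.mulVec_smul r v

/-- The augmentation of the group ring. -/
noncomputable def augmentation (G : Type u) [Group G] : MonoidAlgebra ℤ G →ₐ[ℤ] ℤ :=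
  MonoidAlgebra.lift ℤ ℤ G 1

/-- The group ring is free of rank one as a right module over itself. -/
noncomputable def regularEquiv (G : Type u) [Group G] : MonoidAlgebra ℤ G ≃ₗ[RightZG G] RightZG G where
  toFun := op
  invFun := unop
  map_add' _ _ := rfl
  map_smul' _ _ := rfl
  left_inv _ := rfl
  right_inv _ := rfl

theorem free_columns (G : Type u) [Group G] (k : ℕ) :
    Module.Free (RightZG G) (Fin k → MonoidAlgebra ℤ G) :=
  Module.Free.of_equiv (LinearEquiv.piCongrRight fun _ : Fin k => (regularEquiv G).symm)

theorem finite_columns (G : Type u) [Group G] (k : ℕ) :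
    Module.Finite (RightZG G) (Fin k → MonoidAlgebra ℤ G) :=
  Module.Finite.equiv (LinearEquiv.piCongrRight fun _ : Fin k => (regularEquiv G).symm)

namespace DihedralComplex

/-- The integral group ring of the dihedral group `D_{4n}` of order `4n`. -/
abbrev ZD (n : ℕ) : Type := MonoidAlgebra ℤ (DihedralGroup (2 * n))

/-- The rotation `a`. -/
noncomputable def a (n : ℕ) : ZD n := MonoidAlgebra.of ℤ _ (DihedralGroup.r 1)

/-- The reflection `b`; `a ^ (2n) = b ^ 2 = 1` and `a b a = b`. -/
noncomputable def b (n : ℕ) : ZD n := MonoidAlgebra.of ℤ _ (DihedralGroup.sr 0)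

/-- The sum of the powers of `a`. -/
noncomputable def sigma (n : ℕ) : ZD n := ∑ i ∈ Finset.range (2 * n), a n ^ i

/-- The boundary map `∂₁` of the Cayley complex of `⟨a, b | a^(2n) = b^2 = 1, aba = b⟩`. -/
noncomputable def bd₁ (n : ℕ) : Matrix (Fin 1) (Fin 2) (ZD n) := !![a n - 1, b n - 1]

/-- The boundary map `∂₂` of the same Cayley complex. -/
noncomputable def bd₂ (n : ℕ) : Matrix (Fin 2) (Fin 3) (ZD n) :=
  !![sigma n, 0, 1 + b n * a n;
     0, 1 + b n, a n - 1]

theorem a_mul_b_mul_a (n : ℕ) : a n * b n * a n = b n := by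
  simp only [a, b, ← map_mul]
  simp

theorem b_mul_b (n : ℕ) : b n * b n = 1 := by
  simp only [b, ← map_mul]
  simp [MonoidAlgebra.one_def]

theorem a_pow (n : ℕ) (k : ℕ) : a n ^ k = MonoidAlgebra.of ℤ _ (DihedralGroup.r (k : ZMod (2 * n))) := by
  rw [a, ← map_pow, DihedralGroup.r_one_pow]

theorem a_pow_order (n : ℕ) : a n ^ (2 * n) = 1 := by
  rw [a_pow, ZMod.natCast_self, DihedralGroup.r_zero, map_one]

section Exactness

variable (n : ℕ)

theorem matMap_bd₁ (v : Fin 2 → ZD n) :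
    matMap (bd₁ n) v = ![(a n - 1) * v 0 + (b n - 1) * v 1] := by
  ext i : 1
  fin_cases i
  simp [matMap, bd₁, dotProduct, Fin.sum_univ_two]

theorem matMap_bd₂ (v : Fin 3 → ZD n) :
    matMap (bd₂ n) v = ![sigma n * v 0 + (1 + b n * a n) * v 2,
      (1 + b n) * v 1 + (a n - 1) * v 2] := by
  ext i : 1
  fin_cases i <;>
  simp [matMap, bd₂, dotProduct, Fin.sum_univ_three]

theorem bd₁_bd₂ (v : Fin 3 → ZD n) : matMap (bd₁ n) (matMap (bd₂ n) v) = 0 := by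
  have h1 : (a n - 1) * sigma n = 0 := by
    rw [sigma, mul_geom_sum, a_pow_order, sub_self]
  have h2 : (b n - 1) * (1 + b n) = 0 := by
    have : (b n - 1) * (1 + b n) = b n * b n - 1 := by noncomm_ring
    rw [this, b_mul_b, sub_self]
  have h3 : (a n - 1) * (1 + b n * a n) + (b n - 1) * (a n - 1) = 0 := by
    have : (a n - 1) * (1 + b n * a n) + (b n - 1) * (a n - 1) = a n * b n * a n - b n := by
      noncomm_ring
    rw [this, a_mul_b_mul_a, sub_self]
  rw [matMap_bd₂, matMap_bd₁]
  ext i : 1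
  fin_cases i
  simp only [Matrix.cons_val_zero, Matrix.cons_val_one]
  have : (a n - 1) * (sigma n * v 0 + (1 + b n * a n) * v 2) +
      (b n - 1) * ((1 + b n) * v 1 + (a n - 1) * v 2)
      = ((a n - 1) * sigma n) * v 0 + ((b n - 1) * (1 + b n)) * v 1 +
        ((a n - 1) * (1 + b n * a n) + (b n - 1) * (a n - 1)) * v 2 := by
    noncomm_ring
  simpa [h1, h2, h3] using this

/-- `1 + a + ⋯ + a^(k-1)`. -/
noncomputable def geom (k : ℕ) : ZD n := ∑ i ∈ Finset.range k, a n ^ i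

/-- A chain in the Cayley graph from the identity to a group element. -/
noncomputable def path : DihedralGroup (2 * n) → (Fin 2 → ZD n)
  | .r i => ![geom n i.val, 0]
  | .sr i => ![geom n (-i).val * b n, 1]

/-- The additive extension of `path`. -/
noncomputable def pathHom : ZD n →+ (Fin 2 → ZD n) :=
  AddMonoidHom.mk' (fun x => x.coeff.sum fun g c => c • path n g) (by
    intro x y
    rw [MonoidAlgebra.coeff_add, Finsupp.sum_add_index'] <;> simp [add_smul])

theorem pathHom_of (g : DihedralGroup (2 * n)) : pathHom n (MonoidAlgebra.of ℤ _ g) = path n g := by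
  simp [pathHom]

theorem of_r [NeZero n] (i : ZMod (2 * n)) :
    MonoidAlgebra.of ℤ _ (DihedralGroup.r i) = a n ^ i.val := by
  rw [a_pow, ZMod.natCast_zmod_val]

theorem of_sr [NeZero n] (i : ZMod (2 * n)) :
    MonoidAlgebra.of ℤ _ (DihedralGroup.sr i) = a n ^ (-i).val * b n := by
  rw [a_pow, ZMod.natCast_zmod_val, b, ← map_mul]
  simp

theorem bd₁_path [NeZero n] (g : DihedralGroup (2 * n)) :
    matMap (bd₁ n) (path n g) = ![MonoidAlgebra.of ℤ _ g - 1] := by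
  rw [matMap_bd₁]
  congr 1
  cases g with
  | r i =>
    simp only [path, Matrix.cons_val_zero, Matrix.cons_val_one, mul_zero, add_zero]
    rw [geom, mul_geom_sum, of_r]
  | sr i =>
    simp only [path, Matrix.cons_val_zero, Matrix.cons_val_one, mul_one]
    rw [geom, ← mul_assoc, mul_geom_sum, of_sr]
    noncomm_ring

theorem bd₁_pathHom [NeZero n] (x : ZD n) :
    matMap (bd₁ n) (pathHom n x) = ![x - algebraMap ℤ _ (augmentation _ x)] := by
  induction x using MonoidAlgebra.induction_on with
  | of g => rw [pathHom_of, bd₁_path]; simp [augmentation]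
  | add x y hx hy => rw [map_add, map_add, hx, hy]; simp; abel
  | smul k x hx => rw [map_zsmul, map_zsmul, hx]; simp [mul_sub]

/-- One-cells in the direction of `a` are homologous to differences of chosen paths. -/
theorem cell_a [NeZero n] (g : DihedralGroup (2 * n)) :
    ![MonoidAlgebra.of ℤ _ g, 0] - path n (.r 1 * g) + path n g
      ∈ LinearMap.range (matMap (bd₂ n)) := by
  have key : ∀ i : ZMod (2 * n), geom n (i + 1).val = a n ^ i.val + geom n i.val ∨
      (a n ^ i.val + geom n i.val = sigma n ∧ geom n (i + 1).val = 0) := by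
    intro i
    have hlt := ZMod.val_lt i
    by_cases h : i.val + 1 < 2 * n
    · left
      have : (i + 1).val = i.val + 1 := by
        conv_lhs => rw [← ZMod.natCast_zmod_val i, ← Nat.cast_one, ← Nat.cast_add]
        exact ZMod.val_cast_of_lt h
      rw [this, geom, Finset.sum_range_succ, geom, add_comm]
    · right
      have hi : i.val + 1 = 2 * n := by omega
      have h0 : i + 1 = 0 := by
        rw [← ZMod.natCast_zmod_val i, ← Nat.cast_one, ← Nat.cast_add, hi, ZMod.natCast_self]
      constructor
      · have : sigma n = ∑ j ∈ Finset.range (i.val + 1), a n ^ j := by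
          simp only [hi, sigma]
        rw [this, Finset.sum_range_succ, geom, add_comm]
      · rw [h0]; simp [geom]
  cases g with
  | r i =>
    rw [DihedralGroup.r_mul_r, add_comm 1 i, of_r]
    simp only [path]
    rcases key i with h | ⟨h, h'⟩
    · rw [h]; convert Submodule.zero_mem _ using 1
      ext j : 1; fin_cases j <;> simp
    · rw [h']
      refine ⟨![1, 0, 0], ?_⟩
      rw [matMap_bd₂, ← h]
      ext j : 1; fin_cases j <;> simp
  | sr i =>
    rw [DihedralGroup.r_mul_sr, of_sr]
    simp only [path]
    rw [neg_sub, sub_eq_neg_add 1 i]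
    rcases key (-i) with h | ⟨h, h'⟩
    · rw [h]; convert Submodule.zero_mem _ using 1
      ext j : 1; fin_cases j <;> simp [add_mul]
    · rw [h']
      refine ⟨![b n, 0, 0], ?_⟩
      rw [matMap_bd₂, ← h]
      ext j : 1; fin_cases j <;> simp [add_mul]

/-- One-cells in the direction of `b` are homologous to differences of chosen paths. -/
theorem cell_b [NeZero n] (g : DihedralGroup (2 * n)) :
    ![0, MonoidAlgebra.of ℤ _ g] - path n (.sr 0 * g) + path n g
      ∈ LinearMap.range (matMap (bd₂ n)) := by
  have step : ∀ g : DihedralGroup (2 * n),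
      ![0, MonoidAlgebra.of ℤ _ g] - path n (.sr 0 * g) + path n g
        ∈ LinearMap.range (matMap (bd₂ n)) →
      ![0, MonoidAlgebra.of ℤ _ (.r 1 * g)] - path n (.sr 0 * (.r 1 * g)) + path n (.r 1 * g)
        ∈ LinearMap.range (matMap (bd₂ n)) := by
    intro g hg
    have h1 := cell_a n g
    have h2 := cell_a n (.sr 0 * (.r 1 * g))
    have e : (DihedralGroup.r 1 : DihedralGroup (2 * n)) * (.sr 0 * (.r 1 * g)) = .sr 0 * g := by
      rw [← mul_assoc, ← mul_assoc]; simp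
    rw [e] at h2
    have h3 : matMap (bd₂ n) ![0, 0, MonoidAlgebra.of ℤ _ g] ∈ LinearMap.range (matMap (bd₂ n)) :=
      ⟨_, rfl⟩
    convert Submodule.sub_mem _ (Submodule.add_mem _ hg h3) (Submodule.add_mem _ h1 h2) using 1
    rw [matMap_bd₂]
    have ea : MonoidAlgebra.of ℤ _ (.r 1 * g) = a n * MonoidAlgebra.of ℤ _ g := map_mul _ _ _
    have eb : MonoidAlgebra.of ℤ _ (.sr 0 * (.r 1 * g)) = b n * (a n * MonoidAlgebra.of ℤ _ g) := by
      rw [map_mul, ea]; rfl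
    rw [eb, ea]
    generalize MonoidAlgebra.of ℤ _ g = x
    generalize path n (.sr 0 * (.r 1 * g)) = p₁
    generalize path n (.sr 0 * g) = p₂
    generalize path n (.r 1 * g) = p₃
    generalize path n g = p₄
    funext j
    revert j
    rw [Fin.forall_fin_two]
    constructor
    · simp only [Pi.sub_apply, Pi.add_apply, Matrix.cons_val_zero, mul_zero]
      simp; noncomm_ring
    · simp only [Pi.sub_apply, Pi.add_apply, Matrix.cons_val_one]
      simp; noncomm_ring
  have pow : ∀ (k : ℕ) (g : DihedralGroup (2 * n)),
      ![0, MonoidAlgebra.of ℤ _ g] - path n (.sr 0 * g) + path n g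
        ∈ LinearMap.range (matMap (bd₂ n)) →
      ![0, MonoidAlgebra.of ℤ _ (.r 1 ^ k * g)] - path n (.sr 0 * (.r 1 ^ k * g))
        + path n (.r 1 ^ k * g) ∈ LinearMap.range (matMap (bd₂ n)) := by
    intro k g hg
    induction k with
    | zero => simpa using hg
    | succ k ih =>
      rw [pow_succ', mul_assoc]
      exact step _ ih
  have h1 := fun k => pow k 1 (by
    convert Submodule.zero_mem _ using 1
    rw [mul_one, DihedralGroup.one_def]
    ext j : 1
    fin_cases j <;> simp [path, geom, MonoidAlgebra.one_def])
  have h2 := fun k => pow k (.sr 0) (by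
    refine ⟨![0, 1, 0], ?_⟩
    rw [matMap_bd₂, DihedralGroup.sr_mul_sr]
    ext j : 1
    fin_cases j
    · simp [path, geom]
    · simp [path, geom, b, add_comm])
  cases g with
  | r i =>
    have := h1 i.val
    rwa [mul_one, DihedralGroup.r_one_pow, ZMod.natCast_zmod_val] at this
  | sr i =>
    have := h2 (-i).val
    rwa [DihedralGroup.r_one_pow, ZMod.natCast_zmod_val, DihedralGroup.r_mul_sr, zero_sub,
      neg_neg] at this

theorem sub_pathHom_mem [NeZero n] (y : Fin 2 → ZD n) :
    y - pathHom n (matMap (bd₁ n) y 0) ∈ LinearMap.range (matMap (bd₂ n)) := by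
  have hA : ∀ x : ZD n, ![x, 0] - pathHom n ((a n - 1) * x) ∈ LinearMap.range (matMap (bd₂ n)) := by
    intro x
    induction x using MonoidAlgebra.induction_on with
    | of g =>
      rw [sub_mul, one_mul, map_sub, a, ← map_mul, pathHom_of, pathHom_of, ← sub_add]
      exact cell_a n g
    | add x y hx hy =>
      convert Submodule.add_mem _ hx hy using 1
      have e : (![x + y, 0] : Fin 2 → ZD n) = ![x, 0] + ![y, 0] := by simp
      rw [mul_add, map_add, e]
      abel
    | smul k x hx =>
      convert zsmul_mem hx k using 1
      rw [mul_smul_comm, map_zsmul]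
      have e : (![k • x, 0] : Fin 2 → ZD n) = k • ![x, 0] := by simp
      rw [e, smul_sub]
  have hB : ∀ x : ZD n, ![0, x] - pathHom n ((b n - 1) * x) ∈ LinearMap.range (matMap (bd₂ n)) := by
    intro x
    induction x using MonoidAlgebra.induction_on with
    | of g =>
      rw [sub_mul, one_mul, map_sub, b, ← map_mul, pathHom_of, pathHom_of, ← sub_add]
      exact cell_b n g
    | add x y hx hy =>
      convert Submodule.add_mem _ hx hy using 1
      have e : (![0, x + y] : Fin 2 → ZD n) = ![0, x] + ![0, y] := by simp
      rw [mul_add, map_add, e]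
      abel
    | smul k x hx =>
      convert zsmul_mem hx k using 1
      rw [mul_smul_comm, map_zsmul]
      have e : (![0, k • x] : Fin 2 → ZD n) = k • ![0, x] := by simp
      rw [e, smul_sub]
  convert Submodule.add_mem _ (hA (y 0)) (hB (y 1)) using 1
  have e : y = ![y 0, 0] + ![0, y 1] := by
    ext j : 1; fin_cases j <;> simp
  rw [matMap_bd₁, Matrix.cons_val_zero, map_add]
  nth_rewrite 1 [e]
  abel

end Exactness

/-- The algebraic `2`-complex
`ℤ[D_{4n}]³ → ℤ[D_{4n}]² → ℤ[D_{4n}] → ℤ` of the standard presentation of `D_{4n}`. -/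
noncomputable def complex (n : ℕ) [NeZero n] :
    AlgebraicTwoComplex.{0, 0} (DihedralGroup (2 * n)) where
  F₀ := Fin 1 → ZD n
  F₁ := Fin 2 → ZD n
  F₂ := Fin 3 → ZD n
  free₀ := free_columns _ _
  free₁ := free_columns _ _
  free₂ := free_columns _ _
  fin₀ := finite_columns _ _
  fin₁ := finite_columns _ _
  fin₂ := finite_columns _ _
  d₂ := matMap (bd₂ n)
  d₁ := matMap (bd₁ n)
  ε := (augmentation _).toLinearMap ∘ₗ LinearMap.proj 0
  ε_act := by
    intro g x
    change augmentation _ (x 0 * MonoidAlgebra.of ℤ _ g) = augmentation _ (x 0)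
    rw [map_mul]
    simp [augmentation]
  ε_surjective := fun k => ⟨fun _ => algebraMap ℤ _ k, by simp⟩
  exact₁ := by
    intro y
    constructor
    · intro hy
      have := sub_pathHom_mem n y
      rw [hy] at this
      simpa using this
    · rintro ⟨z, rfl⟩
      exact bd₁_bd₂ n z
  exact₀ := by
    intro x
    constructor
    · intro hx
      refine ⟨pathHom n (x 0), ?_⟩
      have hx' : augmentation _ (x 0) = 0 := hx
      rw [bd₁_pathHom, hx']
      ext i : 1
      fin_cases i
      simp
    · rintro ⟨y, rfl⟩
      change augmentation _ (matMap (bd₁ n) y 0) = 0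
      rw [matMap_bd₁]
      simp [augmentation, a, b]

theorem card_eq (n : ℕ) : Nat.card (DihedralGroup (2 * n)) = 4 * n := by
  rw [DihedralGroup.nat_card]; ring

/-- The Swan map `Aut(J) → (ℤ/4n)ˣ` for `J` the algebraic `π₂` of the above complex. -/
noncomputable def swan (n : ℕ) [NeZero n] :
    ((complex n).J ≃ₗ[RightZG (DihedralGroup (2 * n))] (complex n).J) →* (ZMod (4 * n))ˣ :=
  (complex n).swanMap (4 * n) (card_eq n)

/-- Degree `0` of an explicit chain map from the complex to itself. -/
noncomputable def α₀ (n : ℕ) : Matrix (Fin 1) (Fin 1) (ZD n) := !![1 + a n + b n]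

/-- Degree `1` of the explicit chain map. -/
noncomputable def α₁ (n : ℕ) : Matrix (Fin 2) (Fin 2) (ZD n) :=
  !![1 + a n - b n * a n, b n - 1;
     0, 1]

/-- Degree `2` of the explicit chain map. -/
noncomputable def α₂ (n : ℕ) : Matrix (Fin 3) (Fin 3) (ZD n) :=
  !![1 + a n - b n * a n, 0, 0;
     0, 1, 0;
     0, 0, 1]

end DihedralComplex

/-! The chain map identities are direct computations from `aba = b`, `b² = 1` and the centrality of
`Σ`, and `1 + a + b` has augmentation `3`. The `k`-invariant can be read off from any chain map
(`kInvariant_eq`), so everything rests on the restriction `θ` being bijective on `J`, which follows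
once its determinant over `ℤ` is `-1`.

Since `α₂` changes only the first coordinate, `θ` induces the identity on the image of `J` in the
last two coordinates. Its determinant is therefore that of its restriction to the elements `(x, 0,
0)` of `J`, that is, of left multiplication by `1 + a - ba` on `{x | Σx = 0}`.

Let `Λ = ℤ[t]/(1 + t + ⋯ + t^(2n-1))`. Because `Σ(a - 1) = 0`, the substitution `t ↦ a` followed by
multiplication by `a - 1` embeds `Λ` in `R`, and `{x | Σx = 0} = Λ(a - 1) ⊕ bΛ(a - 1)`
(`annihilatorHom_injective`, `range_annihilatorHom`). In these coordinates `1 + a - ba` becomes a `2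
× 2` matrix over `Λ` (`annihilatorHom_mulVec`) with determinant `(1 + t)(1 + t⁻¹) - 1 = t⁻¹(1 + t +
t²)`. The integral determinant is the norm of this element. The norm of `t` is `-1`, because `Λ` has
odd rank `2n - 1`. The norm of `1 + t + t² = (t³ - 1)/(t - 1)` is `1`, because `t ↦ t³` is an
automorphism of `Λ` when `3` is prime to `2n` (`norm_geom_sum`). -/

open Polynomial

/-! ### Norms in the reduced group ring of a cyclic group -/

/-- The polynomial `1 + X + ⋯ + X ^ (N - 1)`. -/
noncomputable def geomPoly (N : ℕ) : ℤ[X] := ∑ i ∈ Finset.range N, X ^ i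

namespace geomPoly

variable (N : ℕ)

theorem monic [NeZero N] : (geomPoly N).Monic := monic_geom_sum_X (NeZero.ne N)

theorem natDegree_eq [NeZero N] : (geomPoly N).natDegree = N - 1 := by
  have h := congrArg natDegree (geom_sum_mul (X : ℤ[X]) N)
  rw [← C_1, natDegree_X_pow_sub_C, (monic_geom_sum_X (NeZero.ne N)).natDegree_mul
    (monic_X_sub_C 1), natDegree_X_sub_C] at h
  exact Nat.eq_sub_of_add_eq h

theorem eval_one : (geomPoly N).eval 1 = N := by simp [geomPoly, eval_finsetSum]

end geomPoly

/-- The quotient of the integral group ring of the cyclic group of order `N` by the sum of all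
group elements. -/
abbrev ReducedCyclic (N : ℕ) : Type := AdjoinRoot (geomPoly N)

namespace ReducedCyclic

variable (N : ℕ)

/-- The generator of the cyclic group. -/
noncomputable abbrev gen : ReducedCyclic N := AdjoinRoot.root (geomPoly N)

instance [NeZero N] : Module.Free ℤ (ReducedCyclic N) := (geomPoly.monic N).free_adjoinRoot

instance [NeZero N] : Module.Finite ℤ (ReducedCyclic N) := (geomPoly.monic N).finite_adjoinRoot

theorem sum_gen_pow : ∑ i ∈ Finset.range N, gen N ^ i = 0 := by
  have h := AdjoinRoot.mk_self (f := geomPoly N)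
  have e : AdjoinRoot.mk (geomPoly N) (geomPoly N) = ∑ i ∈ Finset.range N, gen N ^ i := by
    conv_lhs => arg 2; unfold geomPoly
    simp
  rwa [← e]

theorem gen_pow : gen N ^ N = 1 := by
  have h := geom_sum_mul (gen N) N
  rw [sum_gen_pow, zero_mul] at h
  exact (sub_eq_zero.1 h.symm)

/-- The norm of the generator of a monogenic algebra is the constant coefficient of its minimal
polynomial, here `1`, up to the sign `(-1)^degree`. -/
theorem norm_gen [NeZero N] : Algebra.norm ℤ (gen N) = (-1) ^ (N - 1) := by
  -- `geomPoly N` is usually reducible, so minimality is checked by degree: a nonzero polynomial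
  -- killing the generator is a multiple of `geomPoly N`.
  have hm : geomPoly N = minpoly ℤ (gen N) := by
    refine minpoly.unique' ℤ _ (geomPoly.monic N) (by simp [AdjoinRoot.aeval_eq]) fun q hq => ?_
    refine or_iff_not_imp_left.2 fun h0 h => ?_
    rw [AdjoinRoot.aeval_eq, AdjoinRoot.mk_eq_zero] at h
    exact (geomPoly.monic N).not_dvd_of_degree_lt h0 hq h
  have h := Algebra.PowerBasis.norm_gen_eq_coeff_zero_minpoly
    (AdjoinRoot.powerBasis' (geomPoly.monic N))
  rw [AdjoinRoot.powerBasis'_gen, AdjoinRoot.powerBasis'_dim, ← hm, geomPoly.natDegree_eq] at h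
  rw [h, coeff_zero_eq_eval_zero, geomPoly, eval_finsetSum]
  have h0 : (0 : ℕ) ∈ Finset.range N := Finset.mem_range.2 (NeZero.pos N)
  rw [Finset.sum_eq_single_of_mem 0 h0 (by intro i _ hi; simp [hi])]
  simp

/-- Modulo `geomPoly N`, the difference `geomPoly N - geomPoly N (1)` is `-N` and is divisible by `t
- 1`. So the norm of `t - 1` divides a power of `-N`. This permits cancelling that norm later. -/
theorem norm_gen_sub_one_ne_zero [NeZero N] : Algebra.norm ℤ (gen N - 1) ≠ 0 := by
  obtain ⟨q, hq⟩ := X_sub_C_dvd_sub_C_eval (a := 1) (p := geomPoly N)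
  have h := congrArg (AdjoinRoot.mk (geomPoly N)) hq
  rw [geomPoly.eval_one] at h
  have h' : algebraMap ℤ (ReducedCyclic N) (-N) = (gen N - 1) * AdjoinRoot.mk _ q := by
    simpa using h
  intro h0
  have := congrArg (Algebra.norm ℤ) h'
  rw [map_mul, h0, zero_mul, Algebra.norm_algebraMap] at this
  exact NeZero.ne N (by simpa using eq_zero_of_pow_eq_zero this)

/-- As `t ^ N = 1`, exponents live in `ZMod N`, and multiplication by the unit `k` permutes them.
This makes `t ↦ t ^ k` well defined. -/
theorem sum_gen_pow_pow [NeZero N] {k : ℕ} (hk : k.Coprime N) :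
    ∑ i ∈ Finset.range N, (gen N ^ k) ^ i = 0 := by
  have hz : ∀ j : ℕ, ∑ i ∈ Finset.range N, (gen N ^ j) ^ i
      = ∑ i : ZMod N, gen N ^ ((j : ZMod N) * i).val := by
    intro j
    refine Finset.sum_nbij' (fun i => (i : ZMod N)) ZMod.val (by simp)
      (fun i _ => Finset.mem_range.2 (ZMod.val_lt i))
      (fun i hi => ZMod.val_cast_of_lt (Finset.mem_range.1 hi)) (by simp) fun i _ => ?_
    rw [← pow_mul, ← Nat.cast_mul, ZMod.val_natCast, ← pow_eq_pow_mod _ (gen_pow N)]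
  have h1 := hz 1
  rw [pow_one, sum_gen_pow] at h1
  rw [hz, h1]
  refine Fintype.sum_equiv (Units.mulLeft (ZMod.unitOfCoprime k hk)) _ _ fun i => ?_
  simp

/-- The ring endomorphism induced by raising group elements to a power prime to `N`. -/
noncomputable def powHom [NeZero N] {k : ℕ} (hk : k.Coprime N) :
    ReducedCyclic N →ₐ[ℤ] ReducedCyclic N :=
  AdjoinRoot.liftAlgHom _ (Algebra.ofId ℤ _) (gen N ^ k) (by
    conv_lhs => arg 3; unfold geomPoly
    rw [eval₂_finsetSum]
    simpa using sum_gen_pow_pow N hk)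

theorem powHom_gen [NeZero N] {k : ℕ} (hk : k.Coprime N) : powHom N hk (gen N) = gen N ^ k := by
  simp [powHom]

theorem powHom_comp [NeZero N] {k m : ℕ} (hk : k.Coprime N) (hm : m.Coprime N)
    (h : (k : ZMod N) * m = 1) : (powHom N hk).comp (powHom N hm) = AlgHom.id ℤ _ := by
  apply AdjoinRoot.algHom_ext
  rw [AlgHom.comp_apply, powHom_gen, map_pow, powHom_gen, AlgHom.id_apply, ← pow_mul]
  have h' : k * m ≡ 1 [MOD N] := (ZMod.natCast_eq_natCast_iff _ _ _).1 (by simpa using h)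
  rw [pow_eq_pow_mod (k * m) (gen_pow N), h', ← pow_eq_pow_mod 1 (gen_pow N), pow_one]

/-- Raising to a power inverse to `k` modulo `N` inverts `powHom`, and norms are invariant under
algebra automorphisms. -/
theorem norm_powHom [NeZero N] {k : ℕ} (hk : k.Coprime N) (x : ReducedCyclic N) :
    Algebra.norm ℤ (powHom N hk x) = Algebra.norm ℤ x := by
  have hu := ZMod.coe_mul_inv_eq_one k hk
  have hm : ((k : ZMod N)⁻¹).val.Coprime N := by
    rw [← ZMod.isUnit_iff_coprime, ZMod.natCast_zmod_val]
    exact IsUnit.of_mul_eq_one _ (by rwa [mul_comm])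
  have h : (k : ZMod N) * (((k : ZMod N)⁻¹).val : ℕ) = 1 := by
    rwa [ZMod.natCast_zmod_val]
  exact Algebra.norm_eq_of_algEquiv (AlgEquiv.ofAlgHom (powHom N hk) (powHom N hm)
    (powHom_comp N hk hm h) (powHom_comp N hm hk (by rwa [mul_comm]))) x

/-- The cyclotomic units `1 + t + ⋯ + t ^ (k - 1)` have norm one. -/
theorem norm_geom_sum [NeZero N] {k : ℕ} (hk : k.Coprime N) :
    Algebra.norm ℤ (∑ i ∈ Finset.range k, gen N ^ i) = 1 := by
  -- Multiplied by `t - 1`, the sum becomes `t ^ k - 1`, the image of `t - 1` under `powHom`, which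
  -- has the same norm as `t - 1`.
  refine mul_right_cancel₀ (norm_gen_sub_one_ne_zero N) ?_
  rw [one_mul, ← map_mul, geom_sum_mul, ← norm_powHom N hk (gen N - 1), map_sub (powHom N hk),
    map_one, powHom_gen]

end ReducedCyclic

/-! ### Determinants and kernels -/

/-- An endomorphism inducing the identity on the image of a linear map to a lattice has the same
determinant as its restriction to the kernel. -/
theorem LinearMap.det_eq_det_restrict_ker {R V P : Type*} [CommRing R] [IsDomain R]
    [IsPrincipalIdealRing R] [AddCommGroup V] [Module R V] [AddCommGroup P] [Module R P]
    [Module.Free R V] [Module.Finite R V] [Module.Free R P] [Module.Finite R P]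
    (g : V →ₗ[R] P) (e : V →ₗ[R] V) (h : ∀ x, g (e x) = g x) :
    LinearMap.det e = LinearMap.det (e.restrict (p := LinearMap.ker g) (q := LinearMap.ker g)
      fun x hx => by rw [LinearMap.mem_ker, h]; exact hx) := by
  have : Module.Free R (V ⧸ LinearMap.ker g) :=
    Module.Free.of_equiv g.quotKerEquivRange.symm
  have hle : LinearMap.ker g ≤ (LinearMap.ker g).comap e :=
    fun x hx => by rw [Submodule.mem_comap, LinearMap.mem_ker, h]; exact hx
  -- The quotient by the kernel is a lattice on which `e` acts trivially, so it contributes a factor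
  -- `1`.
  have hid : (LinearMap.ker g).mapQ (LinearMap.ker g) e hle = LinearMap.id := by
    refine Submodule.linearMap_qext _ (LinearMap.ext fun x => ?_)
    simp only [LinearMap.comp_apply, Submodule.mapQ_apply, Submodule.mkQ_apply, LinearMap.id_apply]
    rw [Submodule.Quotient.eq, LinearMap.mem_ker, map_sub, h, sub_self]
  rw [LinearMap.det_eq_det_mul_det (LinearMap.ker g) e hle, hid, LinearMap.det_id, mul_one]

/-! ### Independence of group elements, and the chain map in low degrees -/

namespace DihedralComplex

variable (n : ℕ)

theorem sigma_mul_a_sub_one : sigma n * (a n - 1) = 0 := by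
  rw [sigma, geom_sum_mul, a_pow_order, sub_self]

theorem aeval_geomPoly : aeval (a n) (geomPoly (2 * n)) = sigma n := by
  simp [geomPoly, sigma]

theorem linearIndependent_rotations {r s : ℤ[X]} (hr : r.natDegree < 2 * n)
    (hs : s.natDegree < 2 * n) (h : aeval (a n) r + b n * aeval (a n) s = 0) :
    r = 0 ∧ s = 0 := by
  have hab : ∀ i : ℕ, b n * a n ^ i = MonoidAlgebra.of ℤ _ (DihedralGroup.sr (i : ZMod (2 * n))) := by
    intro i
    rw [a_pow, b, ← map_mul, DihedralGroup.sr_mul_r, zero_add]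
  rw [aeval_eq_sum_range' hr, aeval_eq_sum_range' hs, Finset.mul_sum] at h
  simp only [mul_smul_comm, hab] at h
  simp only [a_pow] at h
  -- Exponents below `2n` give distinct residues, so each coefficient of the group ring element is a
  -- single polynomial coefficient.
  have key : ∀ i j : ℕ, i < 2 * n → j < 2 * n →
      ((i : ZMod (2 * n)) = j ↔ i = j) := by
    intro i j hi hj
    rw [ZMod.natCast_eq_natCast_iff, Nat.ModEq, Nat.mod_eq_of_lt hi, Nat.mod_eq_of_lt hj]
  constructor
  · ext j
    by_cases hj : j < 2 * n
    · have := congrArg (fun x : ZD n => x.coeff (.r (j : ZMod (2 * n)))) h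
      simp [MonoidAlgebra.coeff_sum, Finsupp.single_apply] at this
      rw [Finset.sum_eq_single_of_mem j (Finset.mem_range.2 hj)] at this
      · simpa using this
      · intro i hi hij
        exact if_neg (mt (key i j (Finset.mem_range.1 hi) hj).1 hij)
    · exact coeff_eq_zero_of_natDegree_lt (by omega)
  · ext j
    by_cases hj : j < 2 * n
    · have := congrArg (fun x : ZD n => x.coeff (.sr (j : ZMod (2 * n)))) h
      simp [MonoidAlgebra.coeff_sum, Finsupp.single_apply] at this
      rw [Finset.sum_eq_single_of_mem j (Finset.mem_range.2 hj)] at this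
      · simpa using this
      · intro i hi hij
        exact if_neg (mt (key i j (Finset.mem_range.1 hi) hj).1 hij)
    · exact coeff_eq_zero_of_natDegree_lt (by omega)

theorem coprime_three (h3 : IsUnit (3 : ZMod (4 * n))) : Nat.Coprime 3 (2 * n) := by
  have : IsUnit ((3 : ℕ) : ZMod (4 * n)) := h3
  rw [ZMod.isUnit_iff_coprime] at this
  exact this.coprime_dvd_right ⟨2, by ring⟩

theorem matMap_α₀ (v : Fin 1 → ZD n) : matMap (α₀ n) v = ![(1 + a n + b n) * v 0] := by
  ext i : 1
  fin_cases i
  simp [matMap, α₀, dotProduct]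

theorem matMap_α₁ (v : Fin 2 → ZD n) :
    matMap (α₁ n) v = ![(1 + a n - b n * a n) * v 0 + (b n - 1) * v 1, v 1] := by
  ext i : 1
  fin_cases i <;> simp [matMap, α₁, dotProduct, Fin.sum_univ_two]

theorem matMap_α₂ (v : Fin 3 → ZD n) :
    matMap (α₂ n) v = ![(1 + a n - b n * a n) * v 0, v 1, v 2] := by
  ext i : 1
  fin_cases i <;> simp [matMap, α₂, dotProduct, Fin.sum_univ_three]

theorem bd₁_α₁ (v : Fin 2 → ZD n) :
    matMap (bd₁ n) (matMap (α₁ n) v) = matMap (α₀ n) (matMap (bd₁ n) v) := by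
  rw [matMap_α₁, matMap_bd₁, matMap_bd₁, matMap_α₀]
  simp only [Matrix.cons_val_zero, Matrix.cons_val_one]
  congr 1
  have e1 := a_mul_b_mul_a n
  have e2 := b_mul_b n
  -- Both sides are expanded freely so that `aba` and `bb` remain visible for the group relations.
  have l : (a n - 1) * ((1 + a n - b n * a n) * v 0 + (b n - 1) * v 1) + (b n - 1) * v 1
      = (a n * a n - a n * b n * a n - 1 + b n * a n) * v 0 + (a n * b n - a n) * v 1 := by
    noncomm_ring
  have r : (1 + a n + b n) * ((a n - 1) * v 0 + (b n - 1) * v 1)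
      = (a n * a n - b n - 1 + b n * a n) * v 0 + (a n * b n - a n + (b n * b n - 1)) * v 1 := by
    noncomm_ring
  rw [l, r, e1, e2, sub_self, add_zero]

theorem sigma_mul_a : sigma n * a n = sigma n := by
  have := sigma_mul_a_sub_one n
  rwa [mul_sub, mul_one, sub_eq_zero] at this

theorem a_mul_sigma : a n * sigma n = sigma n := by
  have : (a n - 1) * sigma n = 0 := by rw [sigma, mul_geom_sum, a_pow_order, sub_self]
  rwa [sub_mul, one_mul, sub_eq_zero] at this

theorem augmentation_α₀ (v : Fin 1 → ZD n) :
    augmentation _ (matMap (α₀ n) v 0) = 3 * augmentation _ (v 0) := by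
  rw [matMap_α₀, Matrix.cons_val_zero, map_mul]
  congr 1
  simp [augmentation, a, b]

variable [NeZero n]

theorem a_mul_pow_pred : a n * a n ^ (2 * n - 1) = 1 := by
  rw [mul_pow_sub_one (NeZero.ne _), a_pow_order]

theorem a_mul_b : a n * b n = b n * a n ^ (2 * n - 1) := by
  conv_rhs => rw [← a_mul_b_mul_a]
  rw [mul_assoc, a_mul_pow_pred, mul_one]

theorem sigma_eq_sum : sigma n = ∑ i : ZMod (2 * n), MonoidAlgebra.of ℤ _ (DihedralGroup.r i) := by
  refine Finset.sum_nbij' (fun i => (i : ZMod (2 * n))) ZMod.val (by simp)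
    (fun i _ => Finset.mem_range.2 (ZMod.val_lt i))
    (fun i hi => ZMod.val_cast_of_lt (Finset.mem_range.1 hi)) (by simp) fun i _ => a_pow n i

theorem sigma_mul_b : sigma n * b n = b n * sigma n := by
  rw [sigma_eq_sum, Finset.sum_mul, Finset.mul_sum]
  refine Fintype.sum_equiv (Equiv.neg _) _ _ fun i => ?_
  rw [b, ← map_mul, ← map_mul, DihedralGroup.r_mul_sr, DihedralGroup.sr_mul_r, zero_sub, zero_add,
    Equiv.neg_apply]

/-! ### The annihilator of `Σ` -/

/-- The reduced group ring of the rotation subgroup, embedded as multiples of `a - 1`. -/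
noncomputable def rotationHom : ReducedCyclic (2 * n) →ₗ[ℤ] ZD n :=
  LinearMap.mulRight ℤ (a n - 1) ∘ₗ (aeval (a n)).toLinearMap ∘ₗ
    AdjoinRoot.modByMonicHom (geomPoly.monic (2 * n))

/-- Any representative may be used: passing to the remainder modulo `geomPoly (2 * n)` changes the
value at `a` by a multiple of `Σ`, which `a - 1` kills. -/
theorem rotationHom_mk (p : ℤ[X]) :
    rotationHom n (AdjoinRoot.mk _ p) = aeval (a n) p * (a n - 1) := by
  have h : aeval (a n) p = aeval (a n) (p %ₘ geomPoly (2 * n))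
      + aeval (a n) (p /ₘ geomPoly (2 * n)) * sigma n := by
    rw [← aeval_geomPoly, ← map_mul, ← map_add, mul_comm (p /ₘ _), modByMonic_add_div]
  rw [h, add_mul, mul_assoc, sigma_mul_a_sub_one, mul_zero, add_zero]
  simp [rotationHom]

theorem rotationHom_gen_pow_mul (k : ℕ) (x : ReducedCyclic (2 * n)) :
    rotationHom n (ReducedCyclic.gen (2 * n) ^ k * x) = a n ^ k * rotationHom n x := by
  obtain ⟨p, rfl⟩ := AdjoinRoot.mk_surjective x
  have h : ReducedCyclic.gen (2 * n) ^ k * AdjoinRoot.mk _ p = AdjoinRoot.mk _ (X ^ k * p) := by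
    simp
  rw [h, rotationHom_mk, rotationHom_mk, map_mul, map_pow, aeval_X, mul_assoc]

theorem rotationHom_gen_mul (x : ReducedCyclic (2 * n)) :
    rotationHom n (ReducedCyclic.gen (2 * n) * x) = a n * rotationHom n x := by
  simpa using rotationHom_gen_pow_mul n 1 x

/-- Two copies of the reduced group ring of the rotations, embedded in the annihilator of `Σ`. -/
noncomputable def annihilatorHom : (Fin 2 → ReducedCyclic (2 * n)) →ₗ[ℤ] ZD n :=
  rotationHom n ∘ₗ LinearMap.proj 0 +
    LinearMap.mulLeft ℤ (b n) ∘ₗ rotationHom n ∘ₗ LinearMap.proj 1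

theorem annihilatorHom_apply (v : Fin 2 → ReducedCyclic (2 * n)) :
    annihilatorHom n v = rotationHom n (v 0) + b n * rotationHom n (v 1) := rfl

theorem annihilatorHom_injective : Function.Injective (annihilatorHom n) := by
  have hN : 0 < n := NeZero.pos n
  rw [← LinearMap.ker_eq_bot, LinearMap.ker_eq_bot']
  intro v hv
  -- Remainders have degree below `2n - 1`, which leaves room for the factor `X - 1` within the
  -- independent powers of `a`.
  have hrep : ∀ x : ReducedCyclic (2 * n), ∃ p : ℤ[X], (p * (X - 1)).natDegree < 2 * n ∧
      AdjoinRoot.mk _ p = x := by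
    intro x
    have hm := geomPoly.monic (2 * n)
    refine ⟨AdjoinRoot.modByMonicHom hm x, ?_, AdjoinRoot.mk_leftInverse hm x⟩
    obtain ⟨p, rfl⟩ := AdjoinRoot.mk_surjective x
    rw [AdjoinRoot.modByMonicHom_mk]
    have h1 : (p %ₘ geomPoly (2 * n)).natDegree < 2 * n - 1 := by
      rw [← geomPoly.natDegree_eq (2 * n)]
      -- The strict bound on degrees needs `geomPoly (2 * n) ≠ 1`, which holds as its degree `2n -
      -- 1` is positive.
      refine natDegree_modByMonic_lt _ hm fun h => ?_
      have := geomPoly.natDegree_eq (2 * n)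
      rw [h, natDegree_one] at this
      omega
    have h2 := natDegree_mul_le (p := p %ₘ geomPoly (2 * n)) (q := X - 1)
    have h3 : (X - 1 : ℤ[X]).natDegree = 1 := natDegree_X_sub_C 1
    omega
  obtain ⟨p, hp, hp'⟩ := hrep (v 0)
  obtain ⟨q, hq, hq'⟩ := hrep (v 1)
  rw [annihilatorHom_apply, ← hp', ← hq', rotationHom_mk, rotationHom_mk] at hv
  have h0 : (X - 1 : ℤ[X]) ≠ 0 := X_sub_C_ne_zero 1
  obtain ⟨h1, h2⟩ := linearIndependent_rotations n hp hq (by simpa using hv)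
  have h1 := (mul_eq_zero.1 h1).resolve_right h0
  have h2 := (mul_eq_zero.1 h2).resolve_right h0
  ext i
  fin_cases i
  · simp [← hp', h1]
  · simp [← hq', h2]

theorem sigma_mul_rotationHom (x : ReducedCyclic (2 * n)) : sigma n * rotationHom n x = 0 := by
  obtain ⟨p, rfl⟩ := AdjoinRoot.mk_surjective x
  have h : sigma n * aeval (a n) p = aeval (a n) p * sigma n := by
    rw [← aeval_geomPoly, ← map_mul, ← map_mul, mul_comm p]
  rw [rotationHom_mk, ← mul_assoc, h, mul_assoc, sigma_mul_a_sub_one, mul_zero]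

/-- Each `a ^ k - 1` is a multiple of `a - 1`, so modulo the image of `annihilatorHom` every group
element is `1` or `b`. -/
theorem exists_add_annihilatorHom (x : ZD n) : ∃ (c d : ℤ) (v : Fin 2 → ReducedCyclic (2 * n)),
    x = c • 1 + d • b n + annihilatorHom n v := by
  have key : ∀ k : ℕ, a n ^ k = 1 + rotationHom n (AdjoinRoot.mk _ (geomPoly k)) := by
    intro k
    rw [rotationHom_mk, geomPoly, map_sum]
    simp [geom_sum_mul]
  induction x using MonoidAlgebra.induction_on with
  | of g =>
    cases g with
    | r i =>
      refine ⟨1, 0, ![AdjoinRoot.mk _ (geomPoly i.val), 0], ?_⟩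
      rw [of_r, key, annihilatorHom_apply]
      simp
    | sr i =>
      refine ⟨0, 1, ![0, AdjoinRoot.mk _ (geomPoly i.val)], ?_⟩
      have h : MonoidAlgebra.of ℤ _ (DihedralGroup.sr i) = b n * a n ^ i.val := by
        rw [a_pow, b, ← map_mul, DihedralGroup.sr_mul_r, zero_add, ZMod.natCast_zmod_val]
      rw [h, key, annihilatorHom_apply]
      simp [mul_add]
  | add x y hx hy =>
    obtain ⟨c, d, v, hx⟩ := hx
    obtain ⟨c', d', v', hy⟩ := hy
    refine ⟨c + c', d + d', v + v', ?_⟩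
    rw [hx, hy, map_add, add_smul, add_smul]
    abel
  | smul k x hx =>
    obtain ⟨c, d, v, hx⟩ := hx
    refine ⟨k * c, k * d, k • v, ?_⟩
    rw [hx, map_zsmul, smul_add, smul_add, smul_smul, smul_smul]

theorem range_annihilatorHom :
    LinearMap.range (annihilatorHom n) = LinearMap.ker (LinearMap.mulLeft ℤ (sigma n)) := by
  have hN : 0 < n := NeZero.pos n
  have hle : ∀ v, sigma n * annihilatorHom n v = 0 := by
    intro v
    rw [annihilatorHom_apply, mul_add, ← mul_assoc, sigma_mul_b, mul_assoc,
      sigma_mul_rotationHom, sigma_mul_rotationHom, mul_zero, add_zero]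
  apply le_antisymm
  · rintro _ ⟨v, rfl⟩
    exact hle v
  · intro x hx
    have hx : sigma n * x = 0 := hx
    obtain ⟨c, d, v, rfl⟩ := exists_add_annihilatorHom n x
    -- What remains is `cΣ + d bΣ = 0`, and independence of the group elements forces `c = d = 0`.
    rw [mul_add, hle, add_zero, mul_add, mul_smul_comm, mul_smul_comm, mul_one, sigma_mul_b,
      ← aeval_geomPoly, ← map_zsmul, ← mul_smul_comm, ← map_zsmul] at hx
    have hdeg : ∀ c : ℤ, (c • geomPoly (2 * n)).natDegree < 2 * n := fun c =>
      (natDegree_smul_le _ _).trans_lt (by rw [geomPoly.natDegree_eq]; omega)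
    have h0 := (geomPoly.monic (2 * n)).ne_zero
    obtain ⟨hc, hd⟩ := linearIndependent_rotations n (hdeg c) (hdeg d) hx
    rw [(smul_eq_zero.1 hc).resolve_right h0, (smul_eq_zero.1 hd).resolve_right h0]
    exact ⟨v, by simp⟩

/-! ### Left multiplication by `1 + a - ba` and its determinant -/

/-- The matrix of left multiplication by `1 + a - ba` on two copies of the reduced group ring of
the rotations. -/
noncomputable def multiplierMatrix : Matrix (Fin 2) (Fin 2) (ReducedCyclic (2 * n)) :=
  !![1 + ReducedCyclic.gen (2 * n), -ReducedCyclic.gen (2 * n) ^ (2 * n - 1);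
     -ReducedCyclic.gen (2 * n), 1 + ReducedCyclic.gen (2 * n) ^ (2 * n - 1)]

/-- The entries come from moving `b` to the front by `ab = ba⁻¹` and `bab = a⁻¹`, with `a⁻¹` written
as `a ^ (2n - 1)`. -/
theorem annihilatorHom_mulVec (v : Fin 2 → ReducedCyclic (2 * n)) :
    annihilatorHom n ((multiplierMatrix n).mulVec v)
      = (1 + a n - b n * a n) * annihilatorHom n v := by
  have h0 : (multiplierMatrix n).mulVec v 0 = v 0 + ReducedCyclic.gen (2 * n) * v 0
      - ReducedCyclic.gen (2 * n) ^ (2 * n - 1) * v 1 := by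
    simp [multiplierMatrix, Matrix.mulVec, dotProduct, Fin.sum_univ_two]; ring
  have h1 : (multiplierMatrix n).mulVec v 1 = v 1 + ReducedCyclic.gen (2 * n) ^ (2 * n - 1) * v 1
      - ReducedCyclic.gen (2 * n) * v 0 := by
    simp [multiplierMatrix, Matrix.mulVec, dotProduct, Fin.sum_univ_two]; ring
  rw [annihilatorHom_apply, annihilatorHom_apply, h0, h1, map_sub, map_sub, map_add, map_add,
    rotationHom_gen_mul, rotationHom_gen_pow_mul]
  have e1 : b n * a n * b n = a n ^ (2 * n - 1) := by
    rw [mul_assoc, a_mul_b, ← mul_assoc, b_mul_b, one_mul]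
  have e2 := a_mul_b n
  generalize a n ^ (2 * n - 1) = c at *
  generalize rotationHom n (v 0) = x
  generalize rotationHom n (v 1) = y
  have e : (1 + a n - b n * a n) * (x + b n * y)
      = x + b n * y + a n * x + (a n * b n) * y - b n * a n * x - (b n * a n * b n) * y := by
    noncomm_ring
  rw [e, e1, e2]
  noncomm_ring

/-- The determinant is `t⁻¹(1 + t + t²)`. The cyclotomic unit has norm `1`, and `t⁻¹ = t ^ (2n - 1)`
has norm `-1` since `2n - 1` is odd both as exponent and as rank. -/
theorem norm_det_multiplierMatrix (h : Nat.Coprime 3 (2 * n)) :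
    Algebra.norm ℤ (multiplierMatrix n).det = -1 := by
  have hp : ReducedCyclic.gen (2 * n) * ReducedCyclic.gen (2 * n) ^ (2 * n - 1) = 1 := by
    rw [mul_pow_sub_one (NeZero.ne _), ReducedCyclic.gen_pow]
  have hd : (multiplierMatrix n).det = ReducedCyclic.gen (2 * n) ^ (2 * n - 1)
      * ∑ i ∈ Finset.range 3, ReducedCyclic.gen (2 * n) ^ i := by
    rw [multiplierMatrix, Matrix.det_fin_two_of]
    simp only [Finset.sum_range_succ, Finset.sum_range_zero]
    linear_combination (-1 - ReducedCyclic.gen (2 * n)) * hp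
  have ho : Odd (2 * n - 1) := by
    have := NeZero.pos n
    exact ⟨n - 1, by omega⟩
  rw [hd, map_mul, map_pow, ReducedCyclic.norm_gen, ReducedCyclic.norm_geom_sum _ h,
    ho.neg_one_pow, ho.neg_one_pow, mul_one]

/-! ### The chain map in degree two and its restriction to `π₂` -/

theorem commute_sigma : sigma n * (1 + a n - b n * a n) = (1 + a n - b n * a n) * sigma n := by
  have e : sigma n * (1 + a n - b n * a n)
      = sigma n + sigma n * a n - (sigma n * b n) * a n := by noncomm_ring
  have e' : (1 + a n - b n * a n) * sigma n
      = sigma n + a n * sigma n - b n * (a n * sigma n) := by noncomm_ring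
  rw [e, e', a_mul_sigma, sigma_mul_b, mul_assoc, sigma_mul_a]

theorem bd₂_α₂ (v : Fin 3 → ZD n) :
    matMap (bd₂ n) (matMap (α₂ n) v) = matMap (α₁ n) (matMap (bd₂ n) v) := by
  rw [matMap_α₂, matMap_bd₂, matMap_bd₂, matMap_α₁]
  simp only [Matrix.cons_val_zero, Matrix.cons_val_one, Matrix.cons_val]
  congr 1
  have e1 := a_mul_b_mul_a n
  have e2 := b_mul_b n
  -- The coefficient of `v 2` is arranged as `1 + ba` plus two terms that vanish by `aba = b` and
  -- `b² = 1`.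
  have r : (1 + a n - b n * a n) * (sigma n * v 0 + (1 + b n * a n) * v 2)
      + (b n - 1) * ((1 + b n) * v 1 + (a n - 1) * v 2)
      = ((1 + a n - b n * a n) * sigma n) * v 0 + (b n * b n - 1) * v 1
        + (1 + b n * a n + (a n * b n * a n - b n) + (1 - b n * (a n * b n * a n))) * v 2 := by
    noncomm_ring
  rw [r, e1, e2, ← commute_sigma, sub_self, sub_self, zero_mul, add_zero, add_zero,
    add_zero, mul_assoc]

/-- The explicit chain map given by left multiplication by `α₀`, `α₁`, `α₂`. -/
noncomputable def chainMap : TwoChainMap (complex n) (complex n) where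
  f₂ := matMap (α₂ n)
  f₁ := matMap (α₁ n)
  f₀ := matMap (α₀ n)
  comm₂ := bd₂_α₂ n
  comm₁ := bd₁_α₁ n

theorem chainMap_inducesMul : (chainMap n).InducesMul 3 := augmentation_α₀ n

/-- The restriction of the chain map to algebraic `π₂`. -/
noncomputable def restriction :
    (complex n).J →ₗ[RightZG (DihedralGroup (2 * n))] (complex n).J :=
  (chainMap n).f₂.restrict fun x hx => by
    rw [LinearMap.mem_ker, (chainMap n).comm₂, LinearMap.mem_ker.1 hx, map_zero]

theorem chainMap_induces : (chainMap n).Induces (restriction n) := fun _ => rfl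

instance : Module.Finite ℤ (complex n).J := by
  have := intFinite (G := DihedralGroup (2 * n)) (complex n).F₂
  exact Module.Finite.of_injective (complex n).J.subtype.toAddMonoidHom.toIntLinearMap
    Subtype.val_injective

/-- A basis over `ℤ` is what gives `LinearMap.det` on `J` its meaning; without a finite basis it is
`1` by default. -/
instance : Module.Free ℤ (complex n).J := by
  have := intFree (G := DihedralGroup (2 * n)) (complex n).F₂
  have : Module.IsTorsionFree ℤ (complex n).J :=
    Function.Injective.moduleIsTorsionFree _
      (Subtype.val_injective (p := (· ∈ (complex n).J))) (fun _ _ => rfl)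
  infer_instance

/-- The projection of algebraic `π₂` to its last two coordinates. -/
noncomputable def lastCoordinates : (complex n).J →ₗ[ℤ] ZD n × ZD n :=
  (AddMonoidHom.mk' (fun x => (x.1 1, x.1 2)) fun _ _ => rfl).toIntLinearMap

theorem restriction_coe (x : (complex n).J) : (restriction n x).1
    = ![(1 + a n - b n * a n) * x.1 0, x.1 1, x.1 2] := matMap_α₂ n x.1

theorem lastCoordinates_restriction (x : (complex n).J) :
    lastCoordinates n ((restriction n).toAddMonoidHom.toIntLinearMap x) = lastCoordinates n x := by
  have h := restriction_coe n x
  exact Prod.ext (congrFun h 1) (congrFun h 2)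

theorem mem_J_iff (x : Fin 3 → ZD n) : x ∈ (complex n).J ↔
    sigma n * x 0 + (1 + b n * a n) * x 2 = 0 ∧ (1 + b n) * x 1 + (a n - 1) * x 2 = 0 := by
  have h : x ∈ (complex n).J ↔ matMap (bd₂ n) x = 0 := Iff.rfl
  rw [h, matMap_bd₂, funext_iff, Fin.forall_fin_two]
  rfl

theorem annihilatorHom_mem_J (v : Fin 2 → ReducedCyclic (2 * n)) :
    ![annihilatorHom n v, 0, 0] ∈ (complex n).J := by
  have h : annihilatorHom n v ∈ LinearMap.ker (LinearMap.mulLeft ℤ (sigma n)) := by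
    rw [← range_annihilatorHom]; exact ⟨v, rfl⟩
  have h : sigma n * annihilatorHom n v = 0 := h
  rw [mem_J_iff]
  simp [h]

/-- The annihilator of `Σ`, as the kernel of the projection of `π₂` to its last coordinates. -/
noncomputable def kernelHom :
    (Fin 2 → ReducedCyclic (2 * n)) →ₗ[ℤ] LinearMap.ker (lastCoordinates n) :=
  AddMonoidHom.toIntLinearMap <| AddMonoidHom.mk'
    (fun v => ⟨⟨![annihilatorHom n v, 0, 0], annihilatorHom_mem_J n v⟩, rfl⟩) fun v w => by
      refine Subtype.ext (Subtype.ext ?_)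
      change ![annihilatorHom n (v + w), 0, 0]
        = ![annihilatorHom n v, 0, 0] + ![annihilatorHom n w, 0, 0]
      simp

theorem kernelHom_coe (v : Fin 2 → ReducedCyclic (2 * n)) :
    (kernelHom n v).1.1 = ![annihilatorHom n v, 0, 0] := rfl

/-- When the last two coordinates vanish, the equations of `J` reduce to `Σx = 0`, whose solutions
are parametrised by `annihilatorHom`. -/
theorem kernelHom_bijective : Function.Bijective (kernelHom n) := by
  constructor
  · intro v w h
    apply annihilatorHom_injective n
    exact congrFun (congrArg (fun x => x.1.1) h) 0
  · intro x
    have h1 : x.1.1 1 = 0 := congrArg Prod.fst x.2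
    have h2 : x.1.1 2 = 0 := congrArg Prod.snd x.2
    have h := ((mem_J_iff n _).1 x.1.2).1
    rw [h2, mul_zero, add_zero] at h
    have h : x.1.1 0 ∈ LinearMap.ker (LinearMap.mulLeft ℤ (sigma n)) := h
    rw [← range_annihilatorHom] at h
    obtain ⟨v, hv⟩ := h
    refine ⟨v, Subtype.ext (Subtype.ext ?_)⟩
    rw [kernelHom_coe, hv]
    refine funext fun i => ?_
    fin_cases i
    · rfl
    · exact h1.symm
    · exact h2.symm

theorem det_restriction (h : Nat.Coprime 3 (2 * n)) :
    LinearMap.det (restriction n).toAddMonoidHom.toIntLinearMap = -1 := by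
  -- The target `-1` is rewritten as the norm of a determinant over `ReducedCyclic (2 * n)`, which
  -- is the determinant over `ℤ` after restriction of scalars. It remains to conjugate by
  -- `kernelHom`.
  rw [LinearMap.det_eq_det_restrict_ker (lastCoordinates n) _ (lastCoordinates_restriction n),
    ← norm_det_multiplierMatrix n h, ← LinearMap.det_toLin', ← LinearMap.det_restrictScalars]
  let e := LinearEquiv.ofBijective (kernelHom n) (kernelHom_bijective n)
  rw [← LinearMap.det_conj ((Matrix.toLin' (multiplierMatrix n)).restrictScalars ℤ) e]
  congr 1
  refine LinearMap.ext fun x => ?_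
  obtain ⟨v, rfl⟩ := e.surjective x
  simp only [LinearMap.comp_apply, LinearEquiv.coe_coe, LinearEquiv.symm_apply_apply]
  refine Subtype.ext (Subtype.ext ?_)
  change (restriction n (kernelHom n v).1).1
    = (kernelHom n ((multiplierMatrix n).mulVec v)).1.1
  rw [restriction_coe, kernelHom_coe, kernelHom_coe, annihilatorHom_mulVec]
  rfl

/-- The automorphism of algebraic `π₂` obtained by restricting the chain map. -/
noncomputable def automorphism (h : Nat.Coprime 3 (2 * n)) :
    (complex n).J ≃ₗ[RightZG (DihedralGroup (2 * n))] (complex n).J :=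
  LinearEquiv.ofBijective (restriction n) <| by
    -- Bijectivity does not depend on the scalars, so a unit determinant over `ℤ` suffices.
    have hu : IsUnit (restriction n).toAddMonoidHom.toIntLinearMap := by
      rw [LinearMap.isUnit_iff_isUnit_det, det_restriction n h]
      exact isUnit_one.neg
    exact (Module.End.isUnit_iff (restriction n).toAddMonoidHom.toIntLinearMap).1 hu

end DihedralComplex

/-! ### The value of the Swan map -/

theorem corollary2p7 (n : ℕ) [NeZero n] (h3 : IsUnit (3 : ZMod (4 * n))) :
    h3.unit ∈ (DihedralComplex.swan n).range ∧
    ∃ (f : TwoChainMap (DihedralComplex.complex n) (DihedralComplex.complex n))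
      (θ : (DihedralComplex.complex n).J ≃ₗ[RightZG (DihedralGroup (2 * n))]
        (DihedralComplex.complex n).J),
      f.f₀ = matMap (DihedralComplex.α₀ n) ∧
      f.f₁ = matMap (DihedralComplex.α₁ n) ∧
      f.f₂ = matMap (DihedralComplex.α₂ n) ∧
      f.InducesMul 3 ∧
      f.Induces θ.toLinearMap ∧
      LinearMap.det (θ.toLinearMap.toAddMonoidHom.toIntLinearMap) = -1 ∧
      DihedralComplex.swan n θ = h3.unit := by
  have hc := DihedralComplex.coprime_three n h3
  have hswan : DihedralComplex.swan n (DihedralComplex.automorphism n hc) = h3.unit := by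
    apply Units.ext
    rw [DihedralComplex.swan, AlgebraicTwoComplex.coe_swanMap, IsUnit.unit_spec,
      AlgebraicTwoComplex.kInvariant_eq _ _ _ (DihedralComplex.automorphism n hc).toLinearMap
        (DihedralComplex.chainMap n) 3
        (DihedralComplex.chainMap_induces n) (DihedralComplex.chainMap_inducesMul n)]
    norm_num
  exact ⟨⟨_, hswan⟩, DihedralComplex.chainMap n, DihedralComplex.automorphism n hc, rfl, rfl, rfl,
    DihedralComplex.chainMap_inducesMul n, DihedralComplex.chainMap_induces n,
    DihedralComplex.det_restriction n hc, hswan⟩
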